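/- Let $\Sigma=\{1,\dots,\sigma\}$ with $\sigma\ge 1$ and let $w$ be a word of length $n$ over $\Sigma$ in which every letter of $\Sigma$ occurs. A word $v$ over $\Sigma$ is called $k$-universal (with respect to $\Sigma$) if its set of (scattered) subsequences of length $k$ is all of $\Sigma^k$, and its universality index $\iota(v)$ is the largest $k$ such that $v$ is $k$-universal, always with respect to this fixed alphabet $\Sigma$. There is an algorithm on the unit-cost word RAM with memory words of $\Theta(\log n)$ bits which, given $w$ (together with $n$ and $\sigma$) and an integer $k$ with $0\le k\le\iota(w)$ (so that $k\le n/\sigma$), computes the minimal number of letter deletions needed to obtain from $w$ a word $v$ with $\iota(v)=k$. Its running time is $O(nk)$ for $k\ge 1$ and $O(n)$ for $k=0$, that is, at most $C\,n\max(k,1)$ steps for an absolute constant $C$ independent of $w$, $\sigma$ and $k$. -/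

import Mathlib

/-! ### Words, subsequences and universality -/

namespace Word

variable {α : Type*}

/-- The set of subsequences (scattered factors) of length `k` of the word `w`. -/
def scatFact (k : ℕ) (w : List α) : Set (List α) :=
  {u | u.Sublist w ∧ u.length = k}

/-- The set of all words of length exactly `k` over the alphabet `A`. -/
def wordsOfLength (A : Finset α) (k : ℕ) : Set (List α) :=
  {u | (∀ a ∈ u, a ∈ A) ∧ u.length = k}

/-- `w` is `k`-universal w.r.t. the alphabet `A`. -/
def IsUniversal (A : Finset α) (k : ℕ) (w : List α) : Prop :=
  scatFact k w = wordsOfLength A k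

/-- The universality index of `w` w.r.t. `A`: the largest `k` such that `w` is `k`-universal.
For a word over a nonempty alphabet this maximum exists, see `isGreatest_universalityIndex`. -/
noncomputable def universalityIndex (A : Finset α) (w : List α) : ℕ :=
  sSup {k | IsUniversal A k w}

theorem isGreatest_universalityIndex {A : Finset α} (hA : A.Nonempty) (w : List α) :
    IsGreatest {k | IsUniversal A k w} (universalityIndex A w) := by
  obtain ⟨a, ha⟩ := hA
  have hbdd : BddAbove {k | IsUniversal A k w} := by
    refine ⟨w.length, fun k hk => ?_⟩
    have h : List.replicate k a ∈ wordsOfLength A k :=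
      ⟨fun b hb => (List.eq_of_mem_replicate hb) ▸ ha, List.length_replicate⟩
    have hk' : scatFact k w = wordsOfLength A k := hk
    rw [← hk'] at h
    simpa using h.1.length_le
  have hne : {k | IsUniversal A k w}.Nonempty := by
    refine ⟨0, ?_⟩
    ext u
    constructor
    · rintro ⟨-, hu⟩
      rw [List.length_eq_zero_iff] at hu
      subst hu
      exact ⟨by simp, rfl⟩
    · rintro ⟨-, hu⟩
      rw [List.length_eq_zero_iff] at hu
      subst hu
      exact ⟨List.nil_sublist w, rfl⟩
  exact ⟨Nat.sSup_mem hne hbdd, fun k hk => le_csSup hbdd hk⟩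

/-- The numbers `d` such that deleting `d` letters (occurrences) of `w` can produce a word whose
universality index w.r.t. `A` is exactly `k`. -/
def deletionCounts (A : Finset α) (w : List α) (k : ℕ) : Set ℕ :=
  {d | ∃ v : List α, v.Sublist w ∧ v.length + d = w.length ∧ universalityIndex A v = k}

end Word

/-! ### The unit-cost word RAM -/

namespace WordRAM

/-- Binary operations on machine words. -/
inductive BinOp
  | add | sub | mul | div | mod | and | or | xor | shiftLeft | shiftRight

/-- The result of an operation on words of `W` bits, i.e. on numbers below `2 ^ W`.
All results are taken modulo `2 ^ W`; in particular subtraction wraps around. -/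
def BinOp.eval (W : ℕ) : BinOp → ℕ → ℕ → ℕ
  | .add, x, y => (x + y) % 2 ^ W
  | .sub, x, y => (x + 2 ^ W - y) % 2 ^ W
  | .mul, x, y => (x * y) % 2 ^ W
  | .div, x, y => (x / y) % 2 ^ W
  | .mod, x, y => (x % y) % 2 ^ W
  | .and, x, y => (x &&& y) % 2 ^ W
  | .or, x, y => (x ||| y) % 2 ^ W
  | .xor, x, y => (x ^^^ y) % 2 ^ W
  | .shiftLeft, x, y => (x <<< y) % 2 ^ W
  | .shiftRight, x, y => (x >>> y) % 2 ^ W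

/-- Instructions. `d`, `a`, `b` are register names, `l` is a line number of the program. -/
inductive Instr
  /-- `R[d] := c` -/
  | const (d c : ℕ)
  /-- `R[d] := R[a] o R[b]` -/
  | op (o : BinOp) (d a b : ℕ)
  /-- `R[d] := M[R[a]]` -/
  | load (d a : ℕ)
  /-- `M[R[a]] := R[b]` -/
  | store (a b : ℕ)
  /-- go to line `l` -/
  | jump (l : ℕ)
  /-- if `R[a] = R[b]` go to line `l` -/
  | jumpEq (a b l : ℕ)
  /-- if `R[a] < R[b]` go to line `l` -/
  | jumpLt (a b l : ℕ)

/-- A program is a finite list of instructions; its lines are numbered from `0`. -/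
abbrev Program := List Instr

/-- A configuration: program counter, registers, and main memory. A program mentions only
finitely many registers. -/
structure Config where
  pc : ℕ
  reg : ℕ → ℕ
  mem : ℕ → ℕ

/-- The effect of one instruction on a machine with `W`-bit words. -/
def Instr.exec (W : ℕ) (i : Instr) (s : Config) : Config :=
  match i with
  | .const d c => ⟨s.pc + 1, Function.update s.reg d (c % 2 ^ W), s.mem⟩
  | .op o d a b => ⟨s.pc + 1, Function.update s.reg d (o.eval W (s.reg a) (s.reg b)), s.mem⟩
  | .load d a => ⟨s.pc + 1, Function.update s.reg d (s.mem (s.reg a)), s.mem⟩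
  | .store a b => ⟨s.pc + 1, s.reg, Function.update s.mem (s.reg a) (s.reg b)⟩
  | .jump l => ⟨l, s.reg, s.mem⟩
  | .jumpEq a b l => ⟨if s.reg a = s.reg b then l else s.pc + 1, s.reg, s.mem⟩
  | .jumpLt a b l => ⟨if s.reg a < s.reg b then l else s.pc + 1, s.reg, s.mem⟩

/-- The machine has halted when the program counter points to no line of the program. -/
def Halted (P : Program) (s : Config) : Prop := P[s.pc]? = none

/-- One step of the machine, at cost one. A halted machine does not move. -/
def step (W : ℕ) (P : Program) (s : Config) : Config :=
  match P[s.pc]? with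
  | none => s
  | some i => i.exec W s

/-- Started in configuration `s`, the program `P` halts after at most `T` steps on a machine with
`W`-bit words, with the number `out` in register `0`. -/
def HaltsWithin (W : ℕ) (P : Program) (s : Config) (T out : ℕ) : Prop :=
  ∃ t ≤ T, Halted P ((step W P)^[t] s) ∧ ((step W P)^[t] s).reg 0 = out

/-- The initial configuration on a word `w` over the integer alphabet `{1, …, σ}` and a number `k`:
registers `0, 1, 2` hold `|w|`, `σ`, `k`, memory cells `0, …, |w| - 1` hold the letters of `w`,
and everything else is `0`. -/
def init (w : List ℕ) (σ k : ℕ) : Config where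
  pc := 0
  reg r := [w.length, σ, k].getD r 0
  mem i := w.getD i 0

/-- A word length of `d` times the number of binary digits of the input size `n`. -/
def wordLength (d n : ℕ) : ℕ := d * (Nat.log 2 n + 1)

end WordRAM

/-! ### Universality under deletion of letters -/

namespace Word

variable {α : Type*}

/-! A word has index at most `k` iff it avoids some word of length `k + 1`. Putting back one deleted
letter raises the index by at most one, so a longest subsequence of `w` of index at most `k` has
index exactly `k`. The task is thus to make some word of length `k + 1` avoidable as cheaply as
possible (`isLeast_deletionCounts`).

Reading `w` from the right, let `cost s t a` be the price of avoiding some `a :: x` with `x` of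
length `t` in the suffix `s`. A new letter `b` affects only the entries at `a = b`: either `b` is
deleted (one more deletion) or it is kept, and then `x` itself has to be avoided, at the price of
the minimum of row `t - 1` (`cost_le_iff`).

Entries never exceed the minimum of the previous row (`cost_le_rowBound`), so an update either
leaves an entry alone or adds one. Row minima then need no search: counting the letters whose entry
exceeds each value `v`, the minimum rises exactly when the counter at the updated entry's old value
reaches `σ` (`minCost_cons`). Each pair of a letter and a row costs constant time, which gives `O(n
(k + 1))` in total. -/

theorem universalityIndex_le_length {A : Finset α} (hA : A.Nonempty)
    (w : List α) : universalityIndex A w ≤ w.length := by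
  have h : IsUniversal A (universalityIndex A w) w :=
    (isGreatest_universalityIndex hA w).1
  obtain ⟨a, ha⟩ := hA
  have hm : List.replicate (universalityIndex A w) a ∈
      wordsOfLength A (universalityIndex A w) :=
    ⟨fun b hb => List.eq_of_mem_replicate hb ▸ ha, List.length_replicate⟩
  rw [← h] at hm
  simpa using hm.1.length_le

theorem universalityIndex_lt_iff {A : Finset α} (hA : A.Nonempty) {v : List α}
    (hv : ∀ a ∈ v, a ∈ A) {k : ℕ} :
    universalityIndex A v < k ↔ ∃ x ∈ wordsOfLength A k, ¬ x.Sublist v := by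
  have hg := isGreatest_universalityIndex hA v
  constructor
  · intro h
    by_contra! hall
    have hk : IsUniversal A k v := by
      ext x
      exact ⟨fun hx => ⟨fun a ha => hv a (hx.1.subset ha), hx.2⟩, fun hx => ⟨hall x hx, hx.2⟩⟩
    exact absurd (hg.2 hk) (not_le.2 h)
  · rintro ⟨x, hx, hxv⟩
    by_contra! hk
    obtain ⟨a, ha⟩ := hA
    have hu : scatFact (universalityIndex A v) v = wordsOfLength A (universalityIndex A v) := hg.1
    -- Padding an avoided word up to the length of the index contradicts universality there.
    have hy : x ++ List.replicate (universalityIndex A v - k) a ∈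
        wordsOfLength A (universalityIndex A v) := by
      refine ⟨fun b hb => ?_, ?_⟩
      · rcases List.mem_append.1 hb with hb | hb
        · exact hx.1 b hb
        · exact List.eq_of_mem_replicate hb ▸ ha
      · have := hx.2
        simp only [List.length_append, List.length_replicate]
        omega
    rw [← hu] at hy
    exact hxv ((List.sublist_append_left _ _).trans hy.1)

theorem exists_insert_sublist {v w : List α} (h : v.Sublist w) (hne : v ≠ w) :
    ∃ p c q, v = p ++ q ∧ (p ++ c :: q).Sublist w := by
  induction h with
  | slnil => exact absurd rfl hne
  | @cons l₁ l₂ a h _ => exact ⟨[], a, l₁, rfl, h.cons_cons a⟩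
  | @cons_cons l₁ l₂ a h ih =>
    obtain ⟨p, c, q, rfl, hq⟩ := ih (fun e => hne (e ▸ rfl))
    exact ⟨a :: p, c, q, rfl, hq.cons_cons a⟩

/-- Inserting a letter raises the index by at most one. If `x.take j` is the longest prefix of `x`
that embeds in `p`, doubling the letter `x[j]` gives the new avoided word: `p` absorbs at most `j`
letters and `c` at most one, which leaves `x.drop j` for `q`. -/
theorem exists_not_sublist_insert {A : Finset α} {k : ℕ} {p q : List α} (c : α)
    (h : ∃ x ∈ wordsOfLength A k, ¬ x.Sublist (p ++ q)) :
    ∃ y ∈ wordsOfLength A (k + 1), ¬ y.Sublist (p ++ c :: q) := by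
  classical
  obtain ⟨x, ⟨hxA, hxk⟩, hx⟩ := h
  set j := Nat.findGreatest (fun j => (x.take j).Sublist p) x.length with hj
  have hjp : (x.take j).Sublist p :=
    Nat.findGreatest_spec (P := fun j => (x.take j).Sublist p) (Nat.zero_le x.length) (by simp)
  have hjl : j < x.length := by
    by_contra! hle
    rw [List.take_of_length_le hle] at hjp
    exact hx (hjp.trans (List.sublist_append_left p q))
  have hmax : ¬ (x.take (j + 1)).Sublist p :=
    Nat.findGreatest_is_greatest (P := fun j => (x.take j).Sublist p) (Nat.lt_succ_self j) hjl
  refine ⟨x.take (j + 1) ++ x.drop j, ⟨fun a ha => ?_, ?_⟩, fun hy => ?_⟩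
  · rcases List.mem_append.1 ha with ha | ha
    · exact hxA a (List.mem_of_mem_take ha)
    · exact hxA a (List.mem_of_mem_drop ha)
  · simp only [List.length_append, List.length_take, List.length_drop]
    omega
  · obtain ⟨y₁, y₂, hy, h₁, h₂⟩ := List.sublist_append_iff.1 hy
    have hlen : y₁.length ≤ j := by
      by_contra! hlt
      have hpre : (x.take (j + 1)) <+: y₁ :=
        List.prefix_of_prefix_length_le (hy ▸ List.prefix_append _ _)
          (List.prefix_append y₁ y₂) (by rw [List.length_take]; omega)
      exact hmax (hpre.sublist.trans h₁)
    have hsuf : (x[j] :: x.drop j) <:+ y₂ := by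
      refine List.suffix_of_suffix_length_le (l₃ := y₁ ++ y₂) ?_ (List.suffix_append _ _) ?_
      · rw [← hy, List.take_succ_eq_append_getElem hjl, List.append_assoc]
        exact List.suffix_append _ _
      · have := congrArg List.length hy
        simp only [List.length_append, List.length_take, List.length_drop, List.length_cons] at this ⊢
        omega
    have hq : (x.drop j).Sublist q := (hsuf.sublist.trans h₂).of_cons_cons
    exact hx (by simpa using hjp.append hq)

/-- For `k` at most the universality index of `w`, the least number of deletions that makes some
word of length `k + 1` avoidable also yields universality index exactly `k`. -/
theorem isLeast_deletionCounts {A : Finset α} (hA : A.Nonempty) {w : List α}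
    (hw : ∀ a ∈ w, a ∈ A) {k m : ℕ} (hk : k ≤ universalityIndex A w)
    (hm : ∀ d, m ≤ d ↔ ∃ v, v.Sublist w ∧ w.length ≤ v.length + d ∧
      ∃ x ∈ wordsOfLength A (k + 1), ¬ x.Sublist v) :
    IsLeast (deletionCounts A w k) m := by
  have hsub : ∀ {v : List α}, v.Sublist w → ∀ a ∈ v, a ∈ A := fun h a ha => hw a (h.subset ha)
  constructor
  · obtain ⟨v, hv, hlen, hx⟩ := (hm m).1 le_rfl
    have hlow : ∀ v' : List α, v'.Sublist w → universalityIndex A v' ≤ k → v'.length + m ≤ w.length := by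
      intro v' hv' hk'
      have := (hm (w.length - v'.length)).2
        ⟨v', hv', by omega, (universalityIndex_lt_iff hA (hsub hv')).1 (Nat.lt_succ_of_le hk')⟩
      have := hv'.length_le
      omega
    have hvk : universalityIndex A v ≤ k :=
      Nat.lt_succ_iff.1 ((universalityIndex_lt_iff hA (hsub hv)).2 hx)
    refine ⟨v, hv, le_antisymm (hlow v hv hvk) hlen, le_antisymm hvk ?_⟩
    -- An index below `k` would leave room to put a letter back, against the maximal length of `v`.
    by_contra! hlt
    obtain ⟨p, c, q, rfl, hpq⟩ := exists_insert_sublist hv (by rintro rfl; omega)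
    have h1 := hlow _ hpq (Nat.lt_succ_iff.1 ((universalityIndex_lt_iff hA (hsub hpq)).2
      (exists_not_sublist_insert c ((universalityIndex_lt_iff hA (hsub hv)).1 hlt))))
    simp only [List.length_append, List.length_cons] at h1 hlen
    omega
  · rintro d ⟨v, hv, hlen, hvk⟩
    exact (hm d).2 ⟨v, hv, hlen.ge, (universalityIndex_lt_iff hA (hsub hv)).1 (by omega)⟩

end Word

/-! ### The recurrence -/

namespace DeletionDP

/-- The upper bound for the entries of row `t`: the least entry of row `t - 1`, or `N` for the
first row. -/
noncomputable def rowBound (σ N : ℕ) (G : ℕ → ℕ → ℕ) : ℕ → ℕ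
  | 0 => N
  | t + 1 => sInf (G t '' Set.Icc 1 σ)

/-- `cost σ N s t a` is the least number of deletions after which `s` avoids `a :: x` for some word
`x` of length `t` over `{1, …, σ}`, see `cost_le_iff`. -/
noncomputable def cost (σ N : ℕ) : List ℕ → ℕ → ℕ → ℕ
  | [], _, _ => 0
  | b :: s, t, a =>
    if a = b then min (cost σ N s t a + 1) (rowBound σ N (cost σ N s) t) else cost σ N s t a

/-- The least entry of row `t`. -/
noncomputable def minCost (σ N : ℕ) (s : List ℕ) (t : ℕ) : ℕ :=
  rowBound σ N (cost σ N s) (t + 1)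

/-- The number of letters whose entry in row `t` exceeds `v`. -/
noncomputable def countAbove (σ N : ℕ) (s : List ℕ) (t v : ℕ) : ℕ :=
  ((Finset.Icc 1 σ).filter fun a => v < cost σ N s t a).card

variable {σ N : ℕ}

theorem minCost_le_iff (hσ : 1 ≤ σ) {s : List ℕ} {t d : ℕ} :
    minCost σ N s t ≤ d ↔ ∃ a ∈ Finset.Icc 1 σ, cost σ N s t a ≤ d := by
  have hne : (cost σ N s t '' Set.Icc 1 σ).Nonempty := ⟨cost σ N s t 1, 1, ⟨le_rfl, hσ⟩, rfl⟩
  constructor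
  · intro h
    obtain ⟨a, ha, he⟩ := Nat.sInf_mem hne
    exact ⟨a, Finset.mem_Icc.2 ha, he.trans_le h⟩
  · rintro ⟨a, ha, h⟩
    have hle : sInf (cost σ N s t '' Set.Icc 1 σ) ≤ cost σ N s t a :=
      Nat.sInf_le ⟨a, Finset.mem_Icc.1 ha, rfl⟩
    exact hle.trans h

theorem cost_le_length (s : List ℕ) (t a : ℕ) : cost σ N s t a ≤ s.length := by
  induction s with
  | nil => exact le_rfl
  | cons b s ih =>
    rw [cost, List.length_cons]
    split_ifs <;> omega

theorem minCost_le_length (hσ : 1 ≤ σ) (s : List ℕ) (t : ℕ) : minCost σ N s t ≤ s.length :=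
  (minCost_le_iff hσ).2 ⟨1, Finset.mem_Icc.2 ⟨le_rfl, hσ⟩, cost_le_length s t 1⟩

/-- The leading `b` is deleted or kept. If `a ≠ b`, keeping it is free, since it cannot start an
embedding of `a :: x`. The form `d = e + 1` rules out deletion when `d = 0`. -/
theorem exists_avoiding_cons_iff {s : List ℕ} {b a t d : ℕ} :
    (∃ v, v.Sublist (b :: s) ∧ (b :: s).length ≤ v.length + d ∧
      ∃ x ∈ Word.wordsOfLength (Finset.Icc 1 σ) t, ¬ (a :: x).Sublist v) ↔
    if a = b then
      (∃ e, d = e + 1 ∧ ∃ v, v.Sublist s ∧ s.length ≤ v.length + e ∧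
        ∃ x ∈ Word.wordsOfLength (Finset.Icc 1 σ) t, ¬ (a :: x).Sublist v) ∨
      (∃ v, v.Sublist s ∧ s.length ≤ v.length + d ∧
        ∃ x ∈ Word.wordsOfLength (Finset.Icc 1 σ) t, ¬ x.Sublist v)
    else ∃ v, v.Sublist s ∧ s.length ≤ v.length + d ∧
        ∃ x ∈ Word.wordsOfLength (Finset.Icc 1 σ) t, ¬ (a :: x).Sublist v := by
  split_ifs with hab
  · subst hab
    constructor
    · rintro ⟨v, hv, hl, x, hx, hxv⟩
      rw [List.length_cons] at hl
      rcases List.sublist_cons_iff.1 hv with hv | ⟨r, rfl, hr⟩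
      · have := hv.length_le
        exact Or.inl ⟨d - 1, by omega, v, hv, by omega, x, hx, hxv⟩
      · rw [List.length_cons] at hl
        exact Or.inr ⟨r, hr, by omega, x, hx, fun h => hxv (h.cons_cons a)⟩
    · rintro (⟨e, rfl, v, hv, hl, x, hx, hxv⟩ | ⟨v, hv, hl, x, hx, hxv⟩)
      · exact ⟨v, hv.cons a, by rw [List.length_cons]; omega, x, hx, hxv⟩
      · exact ⟨a :: v, hv.cons_cons a, by simp only [List.length_cons]; omega, x, hx,
          fun h => hxv h.of_cons_cons⟩
  · constructor
    · rintro ⟨v, hv, hl, x, hx, hxv⟩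
      rw [List.length_cons] at hl
      rcases List.sublist_cons_iff.1 hv with hv | ⟨r, rfl, hr⟩
      · exact ⟨v, hv, by omega, x, hx, hxv⟩
      · rw [List.length_cons] at hl
        exact ⟨r, hr, by omega, x, hx, fun h => hxv (h.cons b)⟩
    · rintro ⟨v, hv, hl, x, hx, hxv⟩
      refine ⟨b :: v, hv.cons_cons b, by simp only [List.length_cons]; omega, x, hx, fun h => ?_⟩
      rcases List.sublist_cons_iff.1 h with h | ⟨r, he, -⟩
      · exact hxv h
      · exact hab (List.cons.inj he).1

theorem exists_avoiding_succ_iff {s : List ℕ} {t d : ℕ} :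
    (∃ v, v.Sublist s ∧ s.length ≤ v.length + d ∧
      ∃ x ∈ Word.wordsOfLength (Finset.Icc 1 σ) (t + 1), ¬ x.Sublist v) ↔
    ∃ a ∈ Finset.Icc 1 σ, ∃ v, v.Sublist s ∧ s.length ≤ v.length + d ∧
      ∃ x ∈ Word.wordsOfLength (Finset.Icc 1 σ) t, ¬ (a :: x).Sublist v := by
  constructor
  · rintro ⟨v, hv, hl, x, ⟨hx, hxl⟩, hxv⟩
    match x, hxl with
    | a :: x, hxl =>
      exact ⟨a, hx a (by simp), v, hv, hl, x,
        ⟨fun b hb => hx b (List.mem_cons_of_mem a hb), by simpa using hxl⟩, hxv⟩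
  · rintro ⟨a, ha, v, hv, hl, x, ⟨hx, hxl⟩, hxv⟩
    refine ⟨v, hv, hl, a :: x, ⟨fun b hb => ?_, by simp [hxl]⟩, hxv⟩
    rcases List.mem_cons.1 hb with rfl | hb
    exacts [ha, hx b hb]

theorem cost_le_iff (hσ : 1 ≤ σ) {s : List ℕ} (hs : s.length ≤ N) (t a d : ℕ) :
    cost σ N s t a ≤ d ↔ ∃ v, v.Sublist s ∧ s.length ≤ v.length + d ∧
      ∃ x ∈ Word.wordsOfLength (Finset.Icc 1 σ) t, ¬ (a :: x).Sublist v := by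
  induction s generalizing t a d with
  | nil =>
    simp only [cost, Nat.zero_le, true_iff]
    refine ⟨[], List.Sublist.slnil, by simp, List.replicate t 1, ⟨fun b hb => ?_, by simp⟩, by simp⟩
    rw [List.eq_of_mem_replicate hb]
    exact Finset.mem_Icc.2 ⟨le_rfl, hσ⟩
  | cons b s ih =>
    rw [List.length_cons] at hs
    have ih := ih (by omega)
    rw [exists_avoiding_cons_iff, cost]
    by_cases hab : a = b
    · rw [if_pos hab]
      simp only [hab, if_true, ← ih]
      have hr : (∃ v, v.Sublist s ∧ s.length ≤ v.length + d ∧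
          ∃ x ∈ Word.wordsOfLength (Finset.Icc 1 σ) t, ¬ x.Sublist v) ↔
          t ≠ 0 ∧ rowBound σ N (cost σ N s) t ≤ d := by
        cases t with
        | zero =>
          simp only [ne_eq, not_true_eq_false, false_and, iff_false]
          rintro ⟨v, hv, hl, x, ⟨-, hx⟩, hxv⟩
          rw [List.length_eq_zero_iff] at hx
          exact hxv (hx ▸ List.nil_sublist v)
        | succ t =>
          rw [exists_avoiding_succ_iff]
          simp only [← ih]
          rw [← minCost_le_iff hσ]
          simp [minCost]
      rw [hr]
      have hl : (∃ e, d = e + 1 ∧ cost σ N s t b ≤ e) ↔ cost σ N s t b + 1 ≤ d :=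
        ⟨by rintro ⟨e, rfl, h⟩; omega, fun h => ⟨d - 1, by omega, by omega⟩⟩
      rw [hl]
      -- In row `0` a kept `b` cannot be avoided. The bound `N` is harmless there, because `cost + 1
      -- ≤ s.length + 1 ≤ N`.
      rcases eq_or_ne t 0 with rfl | ht
      · have := cost_le_length (σ := σ) (N := N) s 0 b
        rw [rowBound]
        omega
      · omega
    · simp only [hab, if_false]
      exact ih t a d

theorem isLeast_minCost {w : List ℕ} {k : ℕ} (hσ : 1 ≤ σ) (hw : w.toFinset = Finset.Icc 1 σ)
    (hk : k ≤ Word.universalityIndex (Finset.Icc 1 σ) w) :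
    IsLeast (Word.deletionCounts (Finset.Icc 1 σ) w k) (minCost σ w.length w k) := by
  refine Word.isLeast_deletionCounts ⟨1, Finset.mem_Icc.2 ⟨le_rfl, hσ⟩⟩
    (fun a ha => hw ▸ List.mem_toFinset.2 ha) hk fun d => ?_
  rw [minCost_le_iff hσ, exists_avoiding_succ_iff]
  simp only [cost_le_iff hσ le_rfl]

/-! ### Constant-time updates of entries, counters and minima -/

theorem cost_le_rowBound (hσ : 1 ≤ σ) {s : List ℕ} (hs : s.length ≤ N) (t a : ℕ) :
    cost σ N s t a ≤ rowBound σ N (cost σ N s) t := by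
  cases t with
  | zero => exact (cost_le_length s 0 a).trans hs
  | succ t =>
    -- A word that avoids `c :: x` also avoids `a :: c :: x`.
    obtain ⟨c, hc, hle⟩ := (minCost_le_iff (N := N) (s := s) (t := t) hσ).1 le_rfl
    obtain ⟨v, hv, hl, x, hx, hxv⟩ :=
      exists_avoiding_succ_iff.2 ⟨c, hc, (cost_le_iff hσ hs t c _).1 hle⟩
    exact (cost_le_iff hσ hs (t + 1) a _).2
      ⟨v, hv, hl, x, hx, fun h => hxv ((List.sublist_cons_self a x).trans h)⟩

theorem minCost_le_iff_countAbove_lt (hσ : 1 ≤ σ) {s : List ℕ} {t d : ℕ} :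
    minCost σ N s t ≤ d ↔ countAbove σ N s t d < σ := by
  have h : countAbove σ N s t d ≤ (Finset.Icc 1 σ).card := Finset.card_filter_le _ _
  have h' := (Finset.card_filter_eq_iff (s := Finset.Icc 1 σ) (p := fun a => d < cost σ N s t a)).not
  rw [Nat.card_Icc, Nat.add_sub_cancel] at h h'
  rw [minCost_le_iff hσ, h.lt_iff_ne, countAbove, ne_eq, h']
  simp [and_assoc]

theorem countAbove_succ_le {s : List ℕ} {t b d v : ℕ} (hb : b ∈ Finset.Icc 1 σ)
    (hd : d < cost σ N s t b) (hv : cost σ N s t b ≤ v) :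
    countAbove σ N s t v + 1 ≤ countAbove σ N s t d := by
  refine Finset.card_lt_card (Finset.ssubset_iff_of_subset ?_ |>.2 ⟨b, ?_, ?_⟩)
  · exact Finset.monotone_filter_right _ fun a _ ha => (hd.trans_le hv).trans ha
  · exact Finset.mem_filter.2 ⟨hb, hd⟩
  · exact fun h => (Finset.mem_filter.1 h).2.not_ge hv

theorem countAbove_cost_lt {s : List ℕ} {t b : ℕ} (hb : b ∈ Finset.Icc 1 σ) :
    countAbove σ N s t (cost σ N s t b) < σ := by
  have hσ : 1 ≤ σ := (Finset.mem_Icc.1 hb).1.trans (Finset.mem_Icc.1 hb).2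
  exact (minCost_le_iff_countAbove_lt hσ).1 ((minCost_le_iff hσ).2 ⟨b, hb, le_rfl⟩)

theorem cost_cons (hσ : 1 ≤ σ) {s : List ℕ} (hs : s.length ≤ N) (b t a : ℕ) :
    cost σ N (b :: s) t a =
      if a = b ∧ cost σ N s t b ≠ rowBound σ N (cost σ N s) t then cost σ N s t b + 1
      else cost σ N s t a := by
  rw [cost]
  have := cost_le_rowBound hσ hs t b
  by_cases hab : a = b
  · subst hab
    simp only [if_true, true_and]
    split_ifs <;> omega
  · simp [hab]

theorem countAbove_cons {s : List ℕ} (hs : s.length ≤ N) {b : ℕ} (hb : b ∈ Finset.Icc 1 σ)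
    (t v : ℕ) :
    countAbove σ N (b :: s) t v =
      if v = cost σ N s t b ∧ cost σ N s t b ≠ rowBound σ N (cost σ N s) t then
        countAbove σ N s t v + 1
      else countAbove σ N s t v := by
  have hσ : 1 ≤ σ := (Finset.mem_Icc.1 hb).1.trans (Finset.mem_Icc.1 hb).2
  unfold countAbove
  split_ifs with h
  · obtain ⟨rfl, h⟩ := h
    rw [← Finset.card_insert_of_notMem (a := b) (by simp)]
    congr 1
    ext a
    rw [Finset.mem_insert, Finset.mem_filter, Finset.mem_filter, cost_cons hσ hs]
    by_cases hab : a = b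
    · subst hab
      simp [h, hb]
    · simp [hab]
  · congr 1
    refine Finset.filter_congr fun a _ => ?_
    rw [cost_cons hσ hs]
    split_ifs with hab
    · obtain ⟨rfl, hab⟩ := hab
      have : v ≠ cost σ N s t a := fun e => h ⟨e, hab⟩
      omega
    · rfl

theorem minCost_cons {s : List ℕ} (hs : s.length ≤ N) {b : ℕ} (hb : b ∈ Finset.Icc 1 σ) (t : ℕ) :
    minCost σ N (b :: s) t =
      if cost σ N s t b ≠ rowBound σ N (cost σ N s) t ∧
          ¬ countAbove σ N s t (cost σ N s t b) + 1 < σ then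
        minCost σ N s t + 1
      else minCost σ N s t := by
  have hσ : 1 ≤ σ := (Finset.mem_Icc.1 hb).1.trans (Finset.mem_Icc.1 hb).2
  have hlt := countAbove_cost_lt (N := N) (s := s) (t := t) hb
  have hmin := (minCost_le_iff_countAbove_lt (N := N) (s := s) (t := t) hσ).2 hlt
  split_ifs with h
  · obtain ⟨h, hc⟩ := h
    -- Were the entry of `b` above the minimum, the counter at the minimum would already have
    -- reached `σ`.
    have hge : cost σ N s t b ≤ minCost σ N s t := by
      by_contra! hd
      have h1 := countAbove_succ_le hb hd le_rfl
      have h2 := (minCost_le_iff_countAbove_lt (N := N) (s := s) (t := t) hσ).1 le_rfl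
      omega
    have heq : minCost σ N s t = cost σ N s t b := le_antisymm hmin hge
    rw [heq]
    apply le_antisymm
    · rw [minCost_le_iff_countAbove_lt hσ, countAbove_cons hs hb, if_neg (by simp),
        ← minCost_le_iff_countAbove_lt hσ]
      omega
    · by_contra! hd
      have := (minCost_le_iff_countAbove_lt hσ).1 (Nat.le_of_lt_succ hd)
      rw [countAbove_cons hs hb, if_pos ⟨rfl, h⟩] at this
      exact hc this
  · refine eq_of_forall_ge_iff fun d => ?_
    rw [minCost_le_iff_countAbove_lt hσ, minCost_le_iff_countAbove_lt hσ, countAbove_cons hs hb]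
    split_ifs with hd
    · obtain ⟨rfl, hd⟩ := hd
      have : countAbove σ N s t (cost σ N s t b) + 1 < σ := by
        by_contra hc
        exact h ⟨hd, hc⟩
      omega
    · rfl

end DeletionDP

/-! ### Running word RAM programs -/

namespace WordRAM

variable {W : ℕ} {P : Program} {T T₁ T₂ : ℕ} {pc d a b l c v : ℕ} {r m : ℕ → ℕ} {o : BinOp}
  {s : Config} {Q Q₁ : Config → Prop}

/-- From `s`, the program reaches a configuration with property `Q` in at most `T` steps. -/
def Leads (W : ℕ) (P : Program) (T : ℕ) (s : Config) (Q : Config → Prop) : Prop :=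
  ∃ t ≤ T, Q ((step W P)^[t] s)

theorem Leads.refl (h : Q s) : Leads W P T s Q := ⟨0, Nat.zero_le T, h⟩

theorem Leads.mono (hT : T₁ ≤ T₂) (h : Leads W P T₁ s Q) : Leads W P T₂ s Q :=
  let ⟨t, ht, hq⟩ := h
  ⟨t, ht.trans hT, hq⟩

theorem Leads.trans (h₁ : Leads W P T₁ s Q₁) (h₂ : ∀ s', Q₁ s' → Leads W P T₂ s' Q) :
    Leads W P (T₁ + T₂) s Q := by
  obtain ⟨t₁, ht₁, h₁⟩ := h₁
  obtain ⟨t₂, ht₂, h₂⟩ := h₂ _ h₁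
  refine ⟨t₂ + t₁, by omega, ?_⟩
  rwa [Function.iterate_add_apply]

theorem Leads.head {i : Instr} (hi : P[s.pc]? = some i) (h : Leads W P T (i.exec W s) Q) :
    Leads W P (T + 1) s Q := by
  obtain ⟨t, ht, h⟩ := h
  refine ⟨t + 1, by omega, ?_⟩
  rwa [Function.iterate_succ_apply, step, hi]

theorem Leads.const (hi : P[pc]? = some (.const d c)) (hv : c % 2 ^ W = v)
    (h : Leads W P T ⟨pc + 1, Function.update r d v, m⟩ Q) : Leads W P (T + 1) ⟨pc, r, m⟩ Q := by
  subst hv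
  exact Leads.head hi h

theorem Leads.op (hi : P[pc]? = some (.op o d a b)) (hv : o.eval W (r a) (r b) = v)
    (h : Leads W P T ⟨pc + 1, Function.update r d v, m⟩ Q) : Leads W P (T + 1) ⟨pc, r, m⟩ Q := by
  subst hv
  exact Leads.head hi h

theorem Leads.load (hi : P[pc]? = some (.load d a)) (hv : m (r a) = v)
    (h : Leads W P T ⟨pc + 1, Function.update r d v, m⟩ Q) : Leads W P (T + 1) ⟨pc, r, m⟩ Q := by
  subst hv
  exact Leads.head hi h

theorem Leads.store (hi : P[pc]? = some (.store a b)) (hc : r a = c) (hv : r b = v)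
    (h : Leads W P T ⟨pc + 1, r, Function.update m c v⟩ Q) : Leads W P (T + 1) ⟨pc, r, m⟩ Q := by
  subst hc hv
  exact Leads.head hi h

theorem Leads.jump (hi : P[pc]? = some (.jump l)) (h : Leads W P T ⟨l, r, m⟩ Q) :
    Leads W P (T + 1) ⟨pc, r, m⟩ Q :=
  Leads.head hi h

theorem Leads.jumpEq_of_eq (hi : P[pc]? = some (.jumpEq a b l)) (hab : r a = r b)
    (h : Leads W P T ⟨l, r, m⟩ Q) : Leads W P (T + 1) ⟨pc, r, m⟩ Q :=
  Leads.head hi (by rwa [Instr.exec, if_pos hab])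

theorem Leads.jumpEq_of_ne (hi : P[pc]? = some (.jumpEq a b l)) (hab : r a ≠ r b)
    (h : Leads W P T ⟨pc + 1, r, m⟩ Q) : Leads W P (T + 1) ⟨pc, r, m⟩ Q :=
  Leads.head hi (by rwa [Instr.exec, if_neg hab])

theorem Leads.jumpLt_of_lt (hi : P[pc]? = some (.jumpLt a b l)) (hab : r a < r b)
    (h : Leads W P T ⟨l, r, m⟩ Q) : Leads W P (T + 1) ⟨pc, r, m⟩ Q :=
  Leads.head hi (by rwa [Instr.exec, if_pos hab])

theorem Leads.jumpLt_of_not_lt (hi : P[pc]? = some (.jumpLt a b l)) (hab : ¬ r a < r b)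
    (h : Leads W P T ⟨pc + 1, r, m⟩ Q) : Leads W P (T + 1) ⟨pc, r, m⟩ Q :=
  Leads.head hi (by rwa [Instr.exec, if_neg hab])

theorem BinOp.eval_add {x y : ℕ} (h : x + y < 2 ^ W) : BinOp.add.eval W x y = x + y :=
  Nat.mod_eq_of_lt h

theorem BinOp.eval_and_self {x : ℕ} (h : x < 2 ^ W) : BinOp.and.eval W x x = x := by
  rw [BinOp.eval, Nat.and_self, Nat.mod_eq_of_lt h]

theorem BinOp.eval_sub {x y : ℕ} (hy : y ≤ x) (hx : x < 2 ^ W) :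
    BinOp.sub.eval W x y = x - y := by
  rw [BinOp.eval, Nat.sub_add_comm hy, Nat.add_mod_right, Nat.mod_eq_of_lt (by omega)]

end WordRAM

/-! ### The program -/

namespace DeletionDP

open WordRAM

/-- The word is read from right to left. Row `t` of the table is kept in the `2 n + 1` cells from
`n + t (2 n + 1)` on: its least entry, its `n` entries, and the `n` numbers `countAbove`. -/
def program : Program :=
  -- `and` of a register with itself serves as a copy; register `16` is never written and supplies
  -- `0`.
  [.const 3 1, .op .add 4 0 0, .op .add 4 4 3, .op .and 5 0 0,
   .jumpEq 5 16 29, .op .sub 5 5 3, .load 6 5, .op .and 7 0 0, .op .and 8 0 0, .const 9 0,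
   .jumpLt 2 9 4, .load 10 8, .op .add 11 8 6, .load 12 11, .jumpEq 12 7 25,
   .op .add 12 12 3, .store 11 12, .op .add 11 8 0, .op .add 11 11 12, .load 13 11,
   .op .add 13 13 3, .store 11 13, .jumpLt 13 1 25, .op .add 13 10 3, .store 8 13,
   .op .and 7 10 10, .op .add 8 8 4, .op .add 9 9 3, .jump 10,
   .op .sub 8 8 4, .load 0 8]

/-- Cell `o` of row `t` of the table after the suffix `s` has been read. -/
noncomputable def cell (σ n : ℕ) (s : List ℕ) (t o : ℕ) : ℕ :=
  if o = 0 then minCost σ n s t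
  else if o ≤ n then cost σ n s t o
  else countAbove σ n s t (o - (n + 1))

/-- The registers that do not change in the inner loop. -/
structure Fixed (n σ k i a : ℕ) (r : ℕ → ℕ) : Prop where
  length : r 0 = n
  alphabet : r 1 = σ
  index : r 2 = k
  one : r 3 = 1
  stride : r 4 = 2 * n + 1
  position : r 5 = i
  letter : r 6 = a
  zero : r 16 = 0

variable {W n σ k i a t B : ℕ} {s : List ℕ} {r m : ℕ → ℕ}

theorem leads_row_end {M : ℕ} (hr : Fixed n σ k i a r) (h8 : r 8 = B) (h9 : r 9 = t)
    (h10 : r 10 = M) (hM : M < 2 ^ W) (hB : B + (2 * n + 1) < 2 ^ W) (ht : t + 1 < 2 ^ W) :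
    Leads W program 4 ⟨25, r, m⟩ fun c =>
      c.pc = 10 ∧ Fixed n σ k i a c.reg ∧ c.reg 7 = M ∧ c.reg 8 = B + (2 * n + 1) ∧
        c.reg 9 = t + 1 ∧ c.mem = m := by
  obtain ⟨h0, h1, h2, h3, h4, h5, h6, h16⟩ := hr
  refine Leads.op (v := M) rfl (by rw [h10, BinOp.eval_and_self hM]) ?_
  refine Leads.op (v := B + (2 * n + 1)) rfl ?_ ?_
  · simp [h8, h4, BinOp.eval_add, hB]
  refine Leads.op (v := t + 1) rfl ?_ ?_
  · simp [h9, h3, BinOp.eval_add, ht]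
  refine Leads.jump rfl (Leads.refl ?_)
  refine ⟨rfl, ⟨?_, ?_, ?_, ?_, ?_, ?_, ?_, ?_⟩, ?_, ?_, ?_, rfl⟩ <;> simp [*]

/-- Rows are updated in place, so register `7` carries the minimum the previous row had before its
update; the longest path takes `15 + 4` steps. -/
theorem leads_row (hn : s.length < n) (hσn : σ ≤ n) (ha : a ∈ Finset.Icc 1 σ)
    (hr : Fixed n σ k i a r) (h7 : r 7 = rowBound σ n (cost σ n s) t) (h8 : r 8 = B)
    (h9 : r 9 = t) (htk : t ≤ k) (hB : B + (2 * n + 1) < 2 ^ W) (ht : t + 1 < 2 ^ W)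
    (hm : ∀ o < 2 * n + 1, m (B + o) = cell σ n s t o) :
    Leads W program 19 ⟨10, r, m⟩ fun c =>
      c.pc = 10 ∧ Fixed n σ k i a c.reg ∧ c.reg 7 = minCost σ n s t ∧
        c.reg 8 = B + (2 * n + 1) ∧ c.reg 9 = t + 1 ∧
        (∀ o < 2 * n + 1, c.mem (B + o) = cell σ n (a :: s) t o) ∧
        ∀ p, (∀ o < 2 * n + 1, p ≠ B + o) → c.mem p = m p := by
  have hr' := hr
  obtain ⟨h0, h1, h2, h3, h4, h5, h6, h16⟩ := hr'
  obtain ⟨ha1, haσ⟩ := Finset.mem_Icc.1 ha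
  have hM : minCost σ n s t ≤ s.length := minCost_le_length (ha1.trans haσ) s t
  have hf : cost σ n s t a ≤ s.length := cost_le_length s t a
  have hc : countAbove σ n s t (cost σ n s t a) < σ := countAbove_cost_lt ha
  have m0 : m B = minCost σ n s t := by simpa [cell] using hm 0 (by omega)
  have ma : m (B + a) = cost σ n s t a := by
    rw [hm a (by omega), cell, if_neg (by omega), if_pos (by omega)]
  have mc : m (B + n + (cost σ n s t a + 1)) = countAbove σ n s t (cost σ n s t a) := by
    rw [show B + n + (cost σ n s t a + 1) = B + (cost σ n s t a + (n + 1)) by omega,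
      hm _ (by omega), cell, if_neg (by omega), if_neg (by omega), Nat.add_sub_cancel]
  refine Leads.jumpLt_of_not_lt rfl (by omega) ?_
  refine Leads.load (v := minCost σ n s t) rfl (by rw [h8, m0]) ?_
  refine Leads.op (v := B + a) rfl ?_ ?_
  · simp only [Function.update_apply]
    norm_num
    rw [h8, h6, BinOp.eval_add (by omega)]
  refine Leads.load (v := cost σ n s t a) rfl (by simp [ma]) ?_
  by_cases hlim : cost σ n s t a = rowBound σ n (cost σ n s) t
  · refine Leads.jumpEq_of_eq rfl (by simp [h7, hlim]) ?_
    refine Leads.mono (T₁ := 4 + 0) (by norm_num) (Leads.trans (leads_row_end (M := minCost σ n s t)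
      (n := n) (σ := σ) (k := k) (i := i) (a := a) (B := B) (t := t)
      ⟨?_, ?_, ?_, ?_, ?_, ?_, ?_, ?_⟩ ?_ ?_ ?_ (by omega) hB ht) ?_)
    any_goals simp [*]; done
    rintro ⟨pc, r', m'⟩ ⟨e, hr', e7, e8, e9, e'⟩
    refine Leads.refl ⟨e, hr', e7, e8, e9, fun o ho => ?_, fun p _ => congrFun e' p⟩
    -- The entry already equals its upper bound, so the whole row stays as it is.
    have he : ∀ v, cell σ n (a :: s) t v = cell σ n s t v := fun v => by
      simp only [cell, minCost_cons hn.le ha, cost_cons (ha1.trans haσ) hn.le,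
        countAbove_cons hn.le ha, hlim, ne_eq, not_true_eq_false, false_and, and_false, if_false]
    rw [he, ← hm o ho]
    exact congrFun e' _
  · refine Leads.jumpEq_of_ne rfl (by simpa [h7] using hlim) ?_
    refine Leads.op (v := cost σ n s t a + 1) rfl ?_ ?_
    · simp only [Function.update_apply]
      norm_num
      rw [h3, BinOp.eval_add (by omega)]
    refine Leads.store (c := B + a) (v := cost σ n s t a + 1) rfl (by simp) (by simp) ?_
    refine Leads.op (v := B + n) rfl ?_ ?_
    · simp only [Function.update_apply]
      norm_num
      rw [h8, h0, BinOp.eval_add (by omega)]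
    refine Leads.op (v := B + n + (cost σ n s t a + 1)) rfl ?_ ?_
    · simp only [Function.update_apply]
      norm_num
      rw [BinOp.eval_add (by omega)]
    refine Leads.load (v := countAbove σ n s t (cost σ n s t a)) rfl ?_ ?_
    · rw [Function.update_self, Function.update_of_ne (by omega), mc]
    refine Leads.op (v := countAbove σ n s t (cost σ n s t a) + 1) rfl ?_ ?_
    · simp only [Function.update_apply]
      norm_num
      rw [h3, BinOp.eval_add (by omega)]
    refine Leads.store (c := B + n + (cost σ n s t a + 1))
      (v := countAbove σ n s t (cost σ n s t a) + 1) rfl (by simp) (by simp) ?_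
    by_cases hbump : countAbove σ n s t (cost σ n s t a) + 1 < σ
    · refine Leads.jumpLt_of_lt rfl (by simpa [h1] using hbump) ?_
      refine Leads.mono (T₁ := 4 + 0) (by norm_num) (Leads.trans (leads_row_end (M := minCost σ n s t)
        (n := n) (σ := σ) (k := k) (i := i) (a := a) (B := B) (t := t)
        ⟨?_, ?_, ?_, ?_, ?_, ?_, ?_, ?_⟩ ?_ ?_ ?_ (by omega) hB ht) ?_)
      any_goals simp [*]; done
      rintro ⟨pc, r', m'⟩ ⟨e, hr', e7, e8, e9, e'⟩
      refine Leads.refl ⟨e, hr', e7, e8, e9, fun o ho => ?_, fun p hp => ?_⟩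
      · simp only at e' ⊢
        have := hm o ho
        simp only [e', Function.update_apply, cell, minCost_cons hn.le ha,
          cost_cons (ha1.trans haσ) hn.le, countAbove_cons hn.le ha] at this ⊢
        grind
      · simp only at e' ⊢
        rw [e', Function.update_of_ne, Function.update_of_ne]
        · exact hp a (by omega)
        · rw [Nat.add_assoc]
          exact hp _ (by omega)
    · refine Leads.jumpLt_of_not_lt rfl (by simpa [h1] using hbump) ?_
      refine Leads.op (v := minCost σ n s t + 1) rfl ?_ ?_
      · simp only [Function.update_apply]
        norm_num
        rw [h3, BinOp.eval_add (by omega)]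
      refine Leads.store (c := B) (v := minCost σ n s t + 1) rfl (by simp [h8]) (by simp) ?_
      refine Leads.trans (T₂ := 0) (leads_row_end (M := minCost σ n s t)
        (n := n) (σ := σ) (k := k) (i := i) (a := a) (B := B) (t := t)
        ⟨?_, ?_, ?_, ?_, ?_, ?_, ?_, ?_⟩ ?_ ?_ ?_ (by omega) hB ht) ?_
      any_goals simp [*]; done
      rintro ⟨pc, r', m'⟩ ⟨e, hr', e7, e8, e9, e'⟩
      refine Leads.refl ⟨e, hr', e7, e8, e9, fun o ho => ?_, fun p hp => ?_⟩
      · simp only at e' ⊢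
        have := hm o ho
        simp only [e', Function.update_apply, cell, minCost_cons hn.le ha,
          cost_cons (ha1.trans haσ) hn.le, countAbove_cons hn.le ha] at this ⊢
        grind
      · simp only at e' ⊢
        rw [e', Function.update_of_ne, Function.update_of_ne, Function.update_of_ne]
        · exact hp a (by omega)
        · rw [Nat.add_assoc]
          exact hp _ (by omega)
        · exact hp 0 (by omega)

/-- The memory holds the word `w` and a table whose row `t` belongs to the suffix `S t`. -/
def Represents (σ n k : ℕ) (w : List ℕ) (S : ℕ → List ℕ) (m : ℕ → ℕ) : Prop :=
  (∀ i < n, m i = w.getD i 0) ∧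
    ∀ t ≤ k, ∀ o < 2 * n + 1, m (n + t * (2 * n + 1) + o) = cell σ n (S t) t o

/-- Loop invariant: rows below `t` include the new letter, the others do not yet. -/
theorem leads_rows {w : List ℕ} (hn : s.length < n) (hσn : σ ≤ n) (ha : a ∈ Finset.Icc 1 σ)
    (hW : n + (k + 1) * (2 * n + 1) < 2 ^ W) (j t : ℕ) (hj : t + j = k + 1)
    (hr : Fixed n σ k i a r) (h7 : r 7 = rowBound σ n (cost σ n s) t)
    (h8 : r 8 = n + t * (2 * n + 1)) (h9 : r 9 = t)
    (hm : Represents σ n k w (fun t' => if t' < t then a :: s else s) m) :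
    Leads W program (19 * j + 1) ⟨10, r, m⟩ fun c =>
      c.pc = 4 ∧ Fixed n σ k i a c.reg ∧ c.reg 8 = n + (k + 1) * (2 * n + 1) ∧
        Represents σ n k w (fun _ => a :: s) c.mem := by
  induction j generalizing t r m with
  | zero =>
    obtain rfl : t = k + 1 := by omega
    refine Leads.jumpLt_of_lt rfl (by rw [hr.index, h9]; omega) (Leads.refl ⟨rfl, hr, h8, hm.1, ?_⟩)
    intro t' ht'
    simpa only [if_pos (Nat.lt_succ_of_le ht')] using hm.2 t' ht'
  | succ j ih =>
    have hle : (t + 1) * (2 * n + 1) ≤ (k + 1) * (2 * n + 1) :=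
      Nat.mul_le_mul_right _ (by omega)
    have hk : k + 1 ≤ (k + 1) * (2 * n + 1) := Nat.le_mul_of_pos_right _ (by omega)
    rw [Nat.succ_mul t] at hle
    rw [show 19 * (j + 1) + 1 = 19 + (19 * j + 1) by ring]
    refine Leads.trans (leads_row hn hσn ha hr h7 h8 h9 (by omega) (by omega) (by omega)
      fun o ho => ?_) ?_
    · simpa only [if_neg (lt_irrefl t)] using hm.2 t (by omega) o ho
    · rintro ⟨pc, r', m'⟩ ⟨rfl, hr', e7, e8, e9, hnew, hold⟩
      dsimp only at e8 hnew hold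
      refine ih (t + 1) (by omega) hr' e7 (by rw [e8]; ring) e9
        ⟨fun p hp => ?_, fun t' ht' o ho => ?_⟩
      · rw [← hm.1 p hp]
        exact hold p fun o _ => by omega
      · dsimp only
        rcases eq_or_ne t' t with rfl | hne
        · rw [if_pos (Nat.lt_succ_self t')]
          exact hnew o ho
        · have h := hm.2 t' ht' o ho
          simp only [show t' < t + 1 ↔ t' < t by omega]
          rw [← h]
          refine hold _ fun q hq => ?_
          rcases Nat.lt_or_gt_of_ne hne with hlt | hlt
          · have := Nat.mul_le_mul_right (2 * n + 1) (Nat.succ_le_of_lt hlt)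
            rw [Nat.succ_mul] at this
            omega
          · have := Nat.mul_le_mul_right (2 * n + 1) (Nat.succ_le_of_lt hlt)
            rw [Nat.succ_mul] at this
            omega

theorem leads_letter {w : List ℕ} (hn : w.length = n) (hσn : σ ≤ n)
    (hw : ∀ b ∈ w, b ∈ Finset.Icc 1 σ) (hW : n + (k + 1) * (2 * n + 1) < 2 ^ W) (hi : i < n)
    (hr : Fixed n σ k (i + 1) a r) (hm : Represents σ n k w (fun _ => w.drop (i + 1)) m) :
    Leads W program (6 + (19 * (k + 1) + 1)) ⟨4, r, m⟩ fun c =>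
      c.pc = 4 ∧ (∃ b, Fixed n σ k i b c.reg) ∧ c.reg 8 = n + (k + 1) * (2 * n + 1) ∧
        Represents σ n k w (fun _ => w.drop i) c.mem := by
  obtain ⟨h0, h1, h2, h3, h4, h5, h6, h16⟩ := hr
  have hiw : i < w.length := hn ▸ hi
  rw [Nat.add_comm 6]
  refine Leads.jumpEq_of_ne rfl (by rw [h5, h16]; omega) ?_
  refine Leads.op (v := i) rfl ?_ ?_
  · rw [h5, h3, BinOp.eval_sub (by omega) (by omega), Nat.add_sub_cancel]
  refine Leads.load (v := w[i]) rfl ?_ ?_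
  · rw [Function.update_self, hm.1 i hi, List.getD_eq_getElem _ _ hiw]
  refine Leads.op (v := n) rfl ?_ ?_
  · simp [h0, BinOp.eval_and_self (show n < 2 ^ W by omega)]
  refine Leads.op (v := n) rfl ?_ ?_
  · simp [h0, BinOp.eval_and_self (show n < 2 ^ W by omega)]
  refine Leads.const (v := 0) rfl (Nat.zero_mod _) ?_
  have hdrop : w.drop i = w[i] :: w.drop (i + 1) := List.drop_eq_getElem_cons hiw
  refine Leads.mono (T₁ := 19 * (k + 1) + 1 + 0) le_rfl (Leads.trans
    (leads_rows (w := w) (s := w.drop (i + 1)) (σ := σ) (n := n) (i := i) (a := w[i]) ?_ hσn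
      (hw _ (List.getElem_mem hiw)) hW (k + 1) 0 (Nat.zero_add _) ⟨?_, ?_, ?_, ?_, ?_, ?_, ?_, ?_⟩
      ?_ ?_ ?_ ?_) ?_)
  · rw [List.length_drop]
    omega
  any_goals simp [h0, h1, h2, h3, h4, h16]; done
  · simp [rowBound]
  · simpa using hm
  · rintro c ⟨e, hc, h8, hmem⟩
    rw [← hdrop] at hmem
    exact Leads.refl ⟨e, ⟨_, hc⟩, h8, hmem⟩

/-- Register `8` matters only on leaving the loop, and every pass sets it; hence it is constrained
only for `i = 0`. -/
theorem leads_word {w : List ℕ} (hn : w.length = n) (hσn : σ ≤ n)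
    (hw : ∀ b ∈ w, b ∈ Finset.Icc 1 σ) (hW : n + (k + 1) * (2 * n + 1) < 2 ^ W) (hi : i ≤ n)
    (hr : Fixed n σ k i a r) (h8 : i = 0 → r 8 = n + (k + 1) * (2 * n + 1))
    (hm : Represents σ n k w (fun _ => w.drop i) m) :
    Leads W program (i * (6 + (19 * (k + 1) + 1)) + 1) ⟨4, r, m⟩ fun c =>
      c.pc = 29 ∧ (∃ b, Fixed n σ k 0 b c.reg) ∧ c.reg 8 = n + (k + 1) * (2 * n + 1) ∧
        Represents σ n k w (fun _ => w) c.mem := by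
  induction i generalizing a r m with
  | zero =>
    refine Leads.mono (T₁ := 0 + 1) (by omega) ?_
    exact Leads.jumpEq_of_eq rfl (by rw [hr.position, hr.zero])
      (Leads.refl ⟨rfl, ⟨a, hr⟩, h8 rfl, hm⟩)
  | succ i ih =>
    rw [Nat.succ_mul, Nat.add_comm (i * _), Nat.add_assoc]
    refine Leads.trans (leads_letter hn hσn hw hW hi hr hm) ?_
    rintro ⟨pc, r', m'⟩ ⟨rfl, ⟨b, hr'⟩, e8, hm'⟩
    exact ih (by omega) hr' (fun _ => e8) hm'

/-- The table of the empty suffix is identically zero, so the memory needs no initialization. -/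
theorem represents_init (w : List ℕ) (hσ : 1 ≤ σ) :
    Represents σ w.length k w (fun _ => []) (init w σ k).mem := by
  refine ⟨fun i _ => rfl, fun t _ o _ => ?_⟩
  have h0 : minCost σ w.length [] t = 0 := Nat.le_zero.1 (minCost_le_length hσ [] t)
  have hz : (init w σ k).mem (w.length + t * (2 * w.length + 1) + o) = 0 :=
    List.getD_eq_default _ _ (by omega)
  rw [hz, cell, h0]
  simp [cost, countAbove]

theorem haltsWithin_program {w : List ℕ} (hσ : 1 ≤ σ) (hw : ∀ b ∈ w, b ∈ Finset.Icc 1 σ)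
    (hσn : σ ≤ w.length) (hW : w.length + (k + 1) * (2 * w.length + 1) < 2 ^ W) :
    HaltsWithin W program (init w σ k) (w.length * (26 + 19 * k) + 7)
      (minCost σ w.length w k) := by
  generalize hn : w.length = n at hσn hW ⊢
  have hk : 2 * n + 1 ≤ (k + 1) * (2 * n + 1) := Nat.le_mul_of_pos_left _ (by omega)
  suffices h : Leads W program (n * (26 + 19 * k) + 1 + 2 + 4) (init w σ k) fun c =>
      Halted program c ∧ c.reg 0 = minCost σ n w k from h
  refine Leads.const (v := 1) rfl (Nat.mod_eq_of_lt (by omega)) ?_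
  refine Leads.op (v := n + n) rfl ?_ ?_
  · simp only [Function.update_apply]
    norm_num
    rw [hn, BinOp.eval_add (by omega)]
  refine Leads.op (v := 2 * n + 1) rfl ?_ ?_
  · simp only [Function.update_apply]
    norm_num
    rw [BinOp.eval_add (by omega)]
    omega
  refine Leads.op (v := n) rfl ?_ ?_
  · simp only [Function.update_apply]
    norm_num
    rw [hn, BinOp.eval_and_self (by omega)]
  rw [show n * (26 + 19 * k) + 1 + 2 = (n * (6 + (19 * (k + 1) + 1)) + 1) + 2 by ring]
  refine Leads.trans (leads_word (w := w) (n := n) (σ := σ) (k := k) (i := n) (a := 0) hn hσn hw hW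
    le_rfl ⟨?_, ?_, ?_, ?_, ?_, ?_, ?_, ?_⟩ (fun h => ?_) ?_) ?_
  any_goals simp [hn]; done
  · omega
  · have := represents_init (k := k) w hσ
    rwa [hn, show [] = w.drop n by rw [← hn, List.drop_length]] at this
  · rintro ⟨pc, r', m'⟩ ⟨rfl, ⟨b, hr'⟩, e8, hm'⟩
    have h4 := hr'.stride
    -- One stride back from the end of the table lies the first cell of row `k`, which holds its
    -- minimum.
    refine Leads.op (v := n + k * (2 * n + 1)) rfl ?_ ?_
    · dsimp only at e8 h4
      rw [e8, h4, BinOp.eval_sub (by omega) hW, Nat.succ_mul]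
      omega
    refine Leads.load (v := minCost σ n w k) rfl ?_ (Leads.refl ⟨rfl, by simp⟩)
    rw [Function.update_self]
    exact hm'.2 k le_rfl 0 (by omega)

end DeletionDP

theorem theorem5 :
    ∃ (P : WordRAM.Program) (C d : ℕ), 1 ≤ d ∧
      ∀ (σ : ℕ) (w : List ℕ) (k : ℕ), 1 ≤ σ → w.toFinset = Finset.Icc 1 σ →
        k ≤ Word.universalityIndex (Finset.Icc 1 σ) w →
        ∃ m : ℕ, IsLeast (Word.deletionCounts (Finset.Icc 1 σ) w k) m ∧
          WordRAM.HaltsWithin (WordRAM.wordLength d w.length) P (WordRAM.init w σ k)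
            (C * (w.length * max k 1)) m := by
  -- `52 = 26 + 19 + 7` bounds the running time because `n ≥ 1`. With `k ≤ n` all addresses stay
  -- below `(n + 1) ^ 4`, hence the word length factor `4`.
  refine ⟨DeletionDP.program, 52, 4, by norm_num, fun σ w k hσ hw hk =>
    ⟨_, DeletionDP.isLeast_minCost hσ hw hk, ?_⟩⟩
  have hσn : σ ≤ w.length := by
    simpa [hw] using List.toFinset_card_le w
  have hkn : k ≤ w.length :=
    hk.trans (Word.universalityIndex_le_length ⟨1, Finset.mem_Icc.2 ⟨le_rfl, hσ⟩⟩ w)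
  have hW : w.length + (k + 1) * (2 * w.length + 1) < 2 ^ WordRAM.wordLength 4 w.length := by
    have hlog : w.length < 2 ^ (Nat.log 2 w.length + 1) := Nat.lt_pow_succ_log_self (by norm_num) _
    have hpow : (w.length + 1) ^ 4 ≤ 2 ^ WordRAM.wordLength 4 w.length := by
      rw [WordRAM.wordLength, Nat.mul_comm, pow_mul]
      exact Nat.pow_le_pow_left hlog 4
    have h1 : (k + 1) * (2 * w.length + 1) ≤ (w.length + 1) * (2 * w.length + 1) :=
      Nat.mul_le_mul_right _ (by omega)
    have h2 : 1 ≤ w.length := hσ.trans hσn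
    refine lt_of_lt_of_le ?_ hpow
    refine lt_of_le_of_lt (Nat.add_le_add_left h1 _) ?_
    obtain ⟨l, hl⟩ := Nat.exists_eq_add_of_le' h2
    rw [hl]
    ring_nf
    nlinarith [Nat.zero_le (l ^ 2), Nat.zero_le (l ^ 3), Nat.zero_le (l ^ 4)]
  obtain ⟨t, ht, h⟩ := DeletionDP.haltsWithin_program hσ
    (fun b hb => hw ▸ List.mem_toFinset.2 hb) hσn hW
  refine ⟨t, ht.trans ?_, h⟩
  have h2 : 1 ≤ w.length := hσ.trans hσn
  have h3 : w.length ≤ w.length * max k 1 := Nat.le_mul_of_pos_right _ (by omega)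
  have h4 : w.length * k ≤ w.length * max k 1 := Nat.mul_le_mul_left _ (le_max_left k 1)
  calc w.length * (26 + 19 * k) + 7 = 26 * w.length + 19 * (w.length * k) + 7 := by ring
    _ ≤ 52 * (w.length * max k 1) := by omega
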